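/- Let $M$ be a closed (i.e. compact, without boundary) smooth manifold of dimension $n$, and let $\omega$ be a volume element on $M$, i.e. a smooth $n$-form that vanishes nowhere (equivalently, an $\mathrm{SL}(n,\mathbb{R})$-structure on $M$). For a smooth vector field $\xi$ on $M$, let $\phi_t$ be the flow with velocity vector $\xi$, let $L_\xi T=\frac{d}{dt}(\phi_t^*T)|_{t=0}$ denote the Lie derivative of a form or a function $T$, and let the logarithmic rate of volumetric expansion $\operatorname{div}_\omega\xi\colon M\to\mathbb{R}$ be the function defined by $L_\xi\omega=(\operatorname{div}_\omega\xi)\,\omega$. Then there is no flow on $M$, with smooth velocity vector field $\xi$, whose logarithmic rate of volumetric expansion is nondecreasing along the flow, i.e. $L_\xi(\operatorname{div}_\omega\xi)\ge 0$ everywhere on $M$, and for which $L_\xi(\operatorname{div}_\omega\xi)>0$ at at least one point of $M$. -/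

import Mathlib

open scoped Manifold ContDiff Topology

namespace VolumeExpansion

/-- The model vector space of an `n`-dimensional manifold. -/
abbrev Model (n : ℕ) : Type := EuclideanSpace ℝ (Fin n)

section

variable {n : ℕ} {M : Type*} [TopologicalSpace M] [ChartedSpace (Model n) M]

variable (n) in
/-- The fibre at `x` of the bundle of alternating `n`-forms on `M`, where `n = dim M`. -/
abbrev TopFormAt (x : M) : Type :=
  TangentSpace (𝓡 n) x [⋀^Fin n]→L[ℝ] (Bundle.Trivial M ℝ x)

variable (n M) in
/-- A volume element on `M`: a smooth section of the bundle of `n`-forms, `n = dim M`, that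
vanishes nowhere. -/
structure VolumeForm [IsManifold (𝓡 n) ∞ M] where
  /-- The value of the form at a point. -/
  form : ∀ x : M, TopFormAt n x
  smooth : ContMDiff (𝓡 n) ((𝓡 n).prod 𝓘(ℝ, Model n [⋀^Fin n]→L[ℝ] ℝ)) ∞
    (fun x ↦ Bundle.TotalSpace.mk' (Model n [⋀^Fin n]→L[ℝ] ℝ)
      (E := fun x : M ↦ TopFormAt n x) x (form x))
  ne_zero : ∀ x, form x ≠ 0

/-- `φ` is a (global) flow, that is, a one-parameter group of smooth transformations depending
smoothly on the parameter, and its velocity vector field is `ξ`. -/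
structure IsFlowOf (ξ : ∀ x : M, TangentSpace (𝓡 n) x) (φ : ℝ → M → M) : Prop where
  smooth : ContMDiff (𝓘(ℝ, ℝ).prod (𝓡 n)) (𝓡 n) ∞ (fun p : ℝ × M ↦ φ p.1 p.2)
  map_zero : ∀ x, φ 0 x = x
  map_add : ∀ s t x, φ (s + t) x = φ s (φ t x)
  velocity : ∀ x, IsMIntegralCurve (fun t ↦ φ t x) ξ

open Classical in
/-- The flow generated by the vector field `ξ`. If `ξ` is smooth and `M` is closed, then `ξ` is
complete, so there is exactly one `φ` with `IsFlowOf ξ φ`, and `flow ξ` is this `φ`.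
(For a field without a global flow the value is the constant family of the identity map.) -/
noncomputable def flow (ξ : ∀ x : M, TangentSpace (𝓡 n) x) : ℝ → M → M :=
  if h : ∃ φ : ℝ → M → M, IsFlowOf ξ φ then h.choose else fun _ x ↦ x

/-- The pullback `f^* Ω` of an `n`-form under a map `f : M → M`. -/
noncomputable def pullback (f : M → M) (Ω : ∀ x : M, TopFormAt n x) (x : M) : TopFormAt n x :=
  (Ω (f x)).compContinuousLinearMap (mfderiv (𝓡 n) (𝓡 n) f x)

/-- The Lie derivative `L_ξ Ω = d/dt (φ_t^* Ω)` at `t = 0` of an `n`-form, with `φ_t` the flow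
of `ξ`. -/
noncomputable def lieDerivForm (ξ : ∀ x : M, TangentSpace (𝓡 n) x)
    (Ω : ∀ x : M, TopFormAt n x) (x : M) : TopFormAt n x :=
  deriv (fun t : ℝ ↦ pullback (flow ξ t) Ω x) 0

/-- The Lie derivative `L_ξ f = d/dt (f ∘ φ_t)` at `t = 0` of a function, with `φ_t` the flow
of `ξ`. -/
noncomputable def lieDerivFun (ξ : ∀ x : M, TangentSpace (𝓡 n) x) (f : M → ℝ) (x : M) : ℝ :=
  deriv (fun t : ℝ ↦ f (flow ξ t x)) 0

/-- The space of alternating `n`-forms on an `n`-dimensional space is one-dimensional. -/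
theorem exists_eq_smul {x : M} (α β : TopFormAt n x) (hβ : β ≠ 0) : ∃ c : ℝ, α = c • β := by
  let e : Module.Basis (Fin n) ℝ (TangentSpace (𝓡 n) x) :=
    (EuclideanSpace.basisFun (Fin n) ℝ).toBasis
  have hα' := AlternatingMap.eq_smul_basis_det e α.toAlternatingMap
  have hβ' := AlternatingMap.eq_smul_basis_det e β.toAlternatingMap
  have hne : β e ≠ 0 := by
    intro h0
    apply hβ
    ext v
    have := congrArg (fun g ↦ g v) hβ'
    simpa [h0] using this
  refine ⟨α e / β e, ?_⟩
  ext v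
  have h1 := congrArg (fun g ↦ g v) hα'
  have h2 := congrArg (fun g ↦ g v) hβ'
  simp only [AlternatingMap.smul_apply, smul_eq_mul,
    ContinuousAlternatingMap.coe_toAlternatingMap] at h1 h2
  simp only [ContinuousAlternatingMap.smul_apply, smul_eq_mul]
  rw [h1, h2]
  field_simp

/-- The divergence (logarithmic rate of change of the volume) `div_Ω ξ`: the function determined
by `L_ξ Ω = (div_Ω ξ) • Ω`. -/
noncomputable def divergence [IsManifold (𝓡 n) ∞ M] (Ω : VolumeForm n M)
    (ξ : ∀ x : M, TangentSpace (𝓡 n) x) (x : M) : ℝ :=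
  (exists_eq_smul (lieDerivForm ξ Ω.form x) (Ω.form x) (Ω.ne_zero x)).choose

theorem lieDerivForm_eq_divergence_smul [IsManifold (𝓡 n) ∞ M] (Ω : VolumeForm n M)
    (ξ : ∀ x : M, TangentSpace (𝓡 n) x) (x : M) :
    lieDerivForm ξ Ω.form x = divergence Ω ξ x • Ω.form x :=
  (exists_eq_smul (lieDerivForm ξ Ω.form x) (Ω.form x) (Ω.ne_zero x)).choose_spec

end

end VolumeExpansion

/-! ### Densities of a volume form in charts, and the Jacobian of a self-map. -/

namespace VolumeExpansion

section

variable {n : ℕ}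

/-! Write `φ_t^* Ω = J_t • Ω`. The group law makes `J` a multiplicative cocycle, so the derivative
of `log |J_t(x)|` in `t` is the divergence at `φ_t x` (`IsFlowOf.hasDerivAt_log_jacobian`). Suppose
the divergence is nondecreasing along orbits and positive at a point. By continuity it exceeds some
`c > 0` on a neighbourhood `W`, and by monotonicity it stays above `c` along all forward orbits from
`W`. Hence `|J_t| ≥ exp (c t)` on `W`, and the volume of `φ_t W` is unbounded, which is impossible
on a compact manifold (`exists_abs_jacobian_lt`). If the divergence is negative somewhere, the same
argument runs backwards in time. So the divergence vanishes identically, and so does its derivative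
along the flow.

No global measure is needed: volumes are Lebesgue measures of chart images, compared through bounds
on the densities over a finite cover. Absolute values make orientations of charts irrelevant. -/

theorem contDiff_continuousLinearMap_det {k : WithTop ℕ∞} :
    ContDiff ℝ k (fun A : Model n →L[ℝ] Model n ↦ A.det) := by
  let e : Module.Basis (Fin n) ℝ (Model n) := (EuclideanSpace.basisFun (Fin n) ℝ).toBasis
  have h (A : Model n →L[ℝ] Model n) : A.det =
      ∑ σ : Equiv.Perm (Fin n), Equiv.Perm.sign σ • ∏ i, A (e i) (σ i) := by
    rw [ContinuousLinearMap.det, ← LinearMap.det_toMatrix e, Matrix.det_apply]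
    simp [LinearMap.toMatrix_apply, e]
  simp_rw [h]
  refine ContDiff.sum fun σ _ ↦ ContDiff.const_smul _ (contDiff_prod fun i _ ↦ ?_)
  exact (EuclideanSpace.proj (σ i) : Model n →L[ℝ] ℝ).contDiff.comp
    (ContinuousLinearMap.apply ℝ (Model n) (e i)).contDiff

variable {M : Type*} [TopologicalSpace M] [ChartedSpace (Model n) M] [IsManifold (𝓡 n) ∞ M]

/-- The coefficient of `Ω` with respect to the coordinate frame of the chart at `p`. -/
noncomputable def VolumeForm.density (Ω : VolumeForm n M) (p x : M) : ℝ :=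
  Ω.form x fun i ↦ (trivializationAt (Model n) (TangentSpace (𝓡 n)) p).symmL ℝ x
    (EuclideanSpace.basisFun (Fin n) ℝ i)

theorem VolumeForm.contMDiffAt_density (Ω : VolumeForm n M) (p : M) :
    ContMDiffAt (𝓡 n) 𝓘(ℝ, ℝ) ∞ (Ω.density p) p := by
  have h := (Bundle.contMDiffAt_section p).1 (Ω.smooth p)
  have h2 := (ContinuousAlternatingMap.apply ℝ (Model n) ℝ
    (fun i : Fin n ↦ EuclideanSpace.basisFun (Fin n) ℝ i)).contMDiff.contMDiffAt.comp p h
  refine h2.congr_of_eventuallyEq (Filter.Eventually.of_forall fun x ↦ ?_)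
  have h3 := FiberBundle.trivializationAt_continuousAlternatingMap_apply (𝕜 := ℝ) (F₁ := Model n)
    (E₁ := fun x : M ↦ TangentSpace (𝓡 n) x) (F₂ := ℝ) (E₂ := Bundle.Trivial M ℝ) p
    ⟨x, Ω.form x⟩
  simp only [Function.comp_apply, h3]
  simp [ContinuousAlternatingMap.inCoordinates, VolumeForm.density, Function.comp_def]

/-- The derivative of `g` at `x`, in the coordinates of the charts at `p` and `q`. -/
noncomputable def coordDeriv (g : M → M) (p q x : M) : Model n →L[ℝ] Model n :=
  ContinuousLinearMap.inCoordinates (Model n) (TangentSpace (𝓡 n)) (Model n) (TangentSpace (𝓡 n))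
    p x q (g x) (mfderiv (𝓡 n) (𝓡 n) g x)

theorem form_symmL (Ω : VolumeForm n M) (q y : M) (v : Fin n → Model n) :
    Ω.form y (fun i ↦ (trivializationAt (Model n) (TangentSpace (𝓡 n)) q).symmL ℝ y (v i)) =
      Ω.density q y * (EuclideanSpace.basisFun (Fin n) ℝ).toBasis.det v := by
  have h := AlternatingMap.eq_smul_basis_det (EuclideanSpace.basisFun (Fin n) ℝ).toBasis
    ((Ω.form y).toAlternatingMap.compLinearMap
      ((trivializationAt (Model n) (TangentSpace (𝓡 n)) q).symmL ℝ y).toLinearMap)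
  have := congrArg (fun a ↦ a v) h
  simpa [VolumeForm.density] using! this

theorem pullback_symmL (Ω : VolumeForm n M) {g : M → M} {p q x : M}
    (hq : g x ∈ (chartAt (Model n) q).source) :
    pullback g Ω.form x (fun i ↦ (trivializationAt (Model n) (TangentSpace (𝓡 n)) p).symmL ℝ x
      (EuclideanSpace.basisFun (Fin n) ℝ i)) = Ω.density q (g x) * (coordDeriv (n := n) g p q x).det := by
  have h := form_symmL Ω q (g x) (fun i ↦ coordDeriv g p q x (EuclideanSpace.basisFun (Fin n) ℝ i))
  have h2 : (EuclideanSpace.basisFun (Fin n) ℝ).toBasis.det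
      (fun i ↦ coordDeriv g p q x (EuclideanSpace.basisFun (Fin n) ℝ i)) =
      (coordDeriv (n := n) g p q x).det := by
    have := Module.Basis.det_comp (EuclideanSpace.basisFun (Fin n) ℝ).toBasis
      (coordDeriv g p q x).toLinearMap (EuclideanSpace.basisFun (Fin n) ℝ).toBasis
    rw [Module.Basis.det_self, mul_one] at this
    rw [ContinuousLinearMap.det, ← this]
    congr 1
  rw [h2] at h
  rw [← h, pullback]
  simp only [ContinuousAlternatingMap.compContinuousLinearMap_apply]
  congr 1
  ext1 i
  simp only [coordDeriv, ContinuousLinearMap.inCoordinates, ContinuousLinearMap.comp_apply,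
    Function.comp_apply]
  exact (Bundle.Trivialization.symmL_continuousLinearMapAt _ (by simpa using hq) _).symm

theorem density_ne_zero (Ω : VolumeForm n M) {p x : M}
    (hx : x ∈ (chartAt (Model n) p).source) : Ω.density p x ≠ 0 := by
  intro h0
  apply Ω.ne_zero x
  ext v
  have h := form_symmL Ω p x
    (fun i ↦ (trivializationAt (Model n) (TangentSpace (𝓡 n)) p).continuousLinearMapAt ℝ x (v i))
  rw [h0, zero_mul] at h
  refine Eq.trans ?_ h
  refine congrArg (Ω.form x) ?_
  ext1 i
  exact (Bundle.Trivialization.symmL_continuousLinearMapAt _ (by simpa using hx) _).symm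

/-- The Jacobian of `g` with respect to `Ω`, determined by `g^* Ω = J • Ω`. -/
noncomputable def jacobian (Ω : VolumeForm n M) (g : M → M) (x : M) : ℝ :=
  (exists_eq_smul (pullback g Ω.form x) (Ω.form x) (Ω.ne_zero x)).choose

theorem pullback_eq_jacobian_smul (Ω : VolumeForm n M) (g : M → M) (x : M) :
    pullback g Ω.form x = jacobian Ω g x • Ω.form x :=
  (exists_eq_smul (pullback g Ω.form x) (Ω.form x) (Ω.ne_zero x)).choose_spec

theorem smul_form_injective (Ω : VolumeForm n M) (x : M) {a b : ℝ}
    (h : a • Ω.form x = b • Ω.form x) : a = b := by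
  obtain ⟨v, hv⟩ : ∃ v, Ω.form x v ≠ 0 := by
    by_contra! h0
    exact Ω.ne_zero x (ContinuousAlternatingMap.ext h0)
  exact mul_right_cancel₀ hv (congrArg (fun α ↦ α v) h)

/-- The bridge from the intrinsic Jacobian to a coordinate determinant; both its smoothness and the
change of variables rest on it. -/
theorem jacobian_mul_density (Ω : VolumeForm n M) {g : M → M} {p q x : M}
    (hq : g x ∈ (chartAt (Model n) q).source) :
    jacobian Ω g x * Ω.density p x = Ω.density q (g x) * (coordDeriv (n := n) g p q x).det := by
  rw [← pullback_symmL Ω hq, pullback_eq_jacobian_smul]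
  rfl

theorem jacobian_id (Ω : VolumeForm n M) (x : M) : jacobian Ω id x = 1 := by
  apply smul_form_injective Ω x
  rw [← pullback_eq_jacobian_smul, one_smul, pullback, mfderiv_id]
  rfl

theorem jacobian_comp (Ω : VolumeForm n M) {g h : M → M} {x : M}
    (hg : MDifferentiableAt (𝓡 n) (𝓡 n) g (h x)) (hh : MDifferentiableAt (𝓡 n) (𝓡 n) h x) :
    jacobian Ω (g ∘ h) x = jacobian Ω g (h x) * jacobian Ω h x := by
  apply smul_form_injective Ω x
  rw [← pullback_eq_jacobian_smul, mul_smul, ← pullback_eq_jacobian_smul, pullback,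
    mfderiv_comp x hg hh]
  have h1 := pullback_eq_jacobian_smul Ω g (h x)
  ext v
  have h2 := congrArg (fun a ↦ a (mfderiv (𝓡 n) (𝓡 n) h x ∘ v)) h1
  exact h2

end

end VolumeExpansion

/-! ### Smoothness of the Jacobian, the cocycle identity, and the divergence as its logarithmic
derivative. -/

namespace VolumeExpansion

section

variable {n : ℕ} {M : Type*} [TopologicalSpace M] [ChartedSpace (Model n) M]

theorem IsFlowOf.mdifferentiable {ξ : ∀ x : M, TangentSpace (𝓡 n) x} {φ : ℝ → M → M}
    (h : IsFlowOf ξ φ) (t : ℝ) : MDifferentiable (𝓡 n) (𝓡 n) (φ t) :=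
  (h.smooth.comp (contMDiff_const.prodMk contMDiff_id) :
    ContMDiff (𝓡 n) (𝓡 n) ∞ (φ t)).mdifferentiable (by simp)

theorem isFlowOf_flow {ξ : ∀ x : M, TangentSpace (𝓡 n) x} (h : ∃ φ, IsFlowOf ξ φ) :
    IsFlowOf ξ (flow ξ) := by
  rw [flow, dif_pos h]
  exact h.choose_spec

variable [IsManifold (𝓡 n) ∞ M]

/-- With the charts frozen at `x₀` and `φ t₀ x₀`, `jacobian_mul_density` expresses the Jacobian near
`(t₀, x₀)` as a quotient of smooth functions. -/
theorem contMDiff_jacobian (Ω : VolumeForm n M) {φ : ℝ → M → M}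
    (hφ : ContMDiff (𝓘(ℝ, ℝ).prod (𝓡 n)) (𝓡 n) ∞ (fun p : ℝ × M ↦ φ p.1 p.2)) :
    ContMDiff (𝓘(ℝ, ℝ).prod (𝓡 n)) 𝓘(ℝ, ℝ) ∞ (fun p : ℝ × M ↦ jacobian Ω (φ p.1) p.2) := by
  rintro ⟨t₀, x₀⟩
  have hD : ContMDiffAt (𝓘(ℝ, ℝ).prod (𝓡 n)) 𝓘(ℝ, Model n →L[ℝ] Model n) ∞
      (fun p : ℝ × M ↦ coordDeriv (n := n) (φ p.1) x₀ (φ t₀ x₀) p.2) (t₀, x₀) := by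
    have hφ' : ContMDiff ((𝓘(ℝ, ℝ).prod (𝓡 n)).prod (𝓡 n)) (𝓡 n) ∞
        (Function.uncurry fun (p : ℝ × M) (y : M) ↦ φ p.1 y) :=
      hφ.comp ((contMDiff_fst.comp contMDiff_fst).prodMk contMDiff_snd)
    exact ContMDiffAt.mfderiv (x₀ := (t₀, x₀)) (fun (p : ℝ × M) (y : M) ↦ φ p.1 y) Prod.snd
      hφ'.contMDiffAt contMDiffAt_snd (show (∞ : WithTop ℕ∞) + 1 ≤ ∞ by simp)
  have hdet : ContMDiffAt (𝓘(ℝ, ℝ).prod (𝓡 n)) 𝓘(ℝ, ℝ) ∞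
      (fun p : ℝ × M ↦ (coordDeriv (n := n) (φ p.1) x₀ (φ t₀ x₀) p.2).det) (t₀, x₀) :=
    contDiff_continuousLinearMap_det.contMDiff.contMDiffAt.comp _ hD
  have hnum : ContMDiffAt (𝓘(ℝ, ℝ).prod (𝓡 n)) 𝓘(ℝ, ℝ) ∞
      (fun p : ℝ × M ↦ Ω.density (φ t₀ x₀) (φ p.1 p.2)) (t₀, x₀) :=
    ContMDiffAt.comp (t₀, x₀) (Ω.contMDiffAt_density (φ t₀ x₀)) hφ.contMDiffAt
  have hden : ContMDiffAt (𝓘(ℝ, ℝ).prod (𝓡 n)) 𝓘(ℝ, ℝ) ∞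
      (fun p : ℝ × M ↦ Ω.density x₀ p.2) (t₀, x₀) :=
    ContMDiffAt.comp (t₀, x₀) (Ω.contMDiffAt_density x₀) contMDiffAt_snd
  have hne : Ω.density x₀ x₀ ≠ 0 := density_ne_zero Ω (mem_chart_source _ _)
  refine ((hnum.mul hdet).mul (hden.inv₀ hne)).congr_of_eventuallyEq ?_
  have h1 : ∀ᶠ p : ℝ × M in 𝓝 (t₀, x₀), φ p.1 p.2 ∈ (chartAt (Model n) (φ t₀ x₀)).source :=
    hφ.continuous.continuousAt.eventually (chart_source_mem_nhds (Model n) (φ t₀ x₀))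
  have h2 : ∀ᶠ p : ℝ × M in 𝓝 (t₀, x₀), p.2 ∈ (chartAt (Model n) x₀).source :=
    continuousAt_snd.eventually (chart_source_mem_nhds (Model n) x₀)
  filter_upwards [h1, h2] with p hp1 hp2
  have := jacobian_mul_density Ω (p := x₀) hp1
  exact (eq_mul_inv_iff_mul_eq₀ (density_ne_zero Ω hp2)).2 this

/-- The logarithmic rate of change of `Ω` under the family `φ`, at time `0`. -/
noncomputable def expansionRate (Ω : VolumeForm n M) (φ : ℝ → M → M) (x : M) : ℝ :=
  deriv (fun t ↦ jacobian Ω (φ t) x) 0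

theorem hasDerivAt_jacobian_zero (Ω : VolumeForm n M) {φ : ℝ → M → M}
    (hφ : ContMDiff (𝓘(ℝ, ℝ).prod (𝓡 n)) (𝓡 n) ∞ (fun p : ℝ × M ↦ φ p.1 p.2)) (x : M) :
    HasDerivAt (fun t ↦ jacobian Ω (φ t) x) (expansionRate Ω φ x) 0 := by
  have h : ContMDiff 𝓘(ℝ, ℝ) 𝓘(ℝ, ℝ) ∞ (fun t : ℝ ↦ jacobian Ω (φ t) x) :=
    (contMDiff_jacobian Ω hφ).comp (contMDiff_id.prodMk contMDiff_const)
  exact (h.contDiff.differentiable (by simp) 0).hasDerivAt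

theorem contMDiff_expansionRate (Ω : VolumeForm n M) {φ : ℝ → M → M}
    (hφ : ContMDiff (𝓘(ℝ, ℝ).prod (𝓡 n)) (𝓡 n) ∞ (fun p : ℝ × M ↦ φ p.1 p.2)) :
    ContMDiff (𝓡 n) 𝓘(ℝ, ℝ) ∞ (expansionRate Ω φ) := by
  intro x₀
  -- Here the point of `M` is the parameter and time is the variable of differentiation.
  have h := ContMDiffAt.mfderiv (n := ∞) (m := ∞) (I := 𝓘(ℝ, ℝ)) (I' := 𝓘(ℝ, ℝ)) (J := 𝓡 n)
    (x₀ := x₀) (fun (x : M) (t : ℝ) ↦ jacobian Ω (φ t) x) (fun _ ↦ 0)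
    (((contMDiff_jacobian Ω hφ).comp (contMDiff_snd.prodMk contMDiff_fst)).contMDiffAt)
    contMDiffAt_const (by simp)
  have h1 := inTangentCoordinates_model_space (I := 𝓘(ℝ, ℝ)) (I' := 𝓘(ℝ, ℝ)) (fun _ : M ↦ (0 : ℝ))
    (fun x ↦ jacobian Ω (φ 0) x) (fun x ↦ fderiv ℝ (fun t ↦ jacobian Ω (φ t) x) 0) x₀
  simp_rw [mfderiv_eq_fderiv] at h
  replace h := h.congr_of_eventuallyEq (f₁ := fun x ↦ fderiv ℝ (fun t ↦ jacobian Ω (φ t) x) 0)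
    (Filter.Eventually.of_forall fun x ↦ (congrFun h1 x).symm)
  have h2 := (ContinuousLinearMap.apply ℝ ℝ (1 : ℝ)).contMDiff.contMDiffAt.comp x₀ h
  refine h2.congr_of_eventuallyEq (Filter.Eventually.of_forall fun x ↦ ?_)
  rfl

theorem IsFlowOf.jacobian_add {ξ : ∀ x : M, TangentSpace (𝓡 n) x} {φ : ℝ → M → M}
    (h : IsFlowOf ξ φ) (Ω : VolumeForm n M) (s t : ℝ) (x : M) :
    jacobian Ω (φ (s + t)) x = jacobian Ω (φ s) (φ t x) * jacobian Ω (φ t) x := by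
  rw [← jacobian_comp Ω (h.mdifferentiable s _) (h.mdifferentiable t _)]
  congr 1
  ext y
  exact h.map_add s t y

theorem IsFlowOf.jacobian_zero {ξ : ∀ x : M, TangentSpace (𝓡 n) x} {φ : ℝ → M → M}
    (h : IsFlowOf ξ φ) (Ω : VolumeForm n M) (x : M) : jacobian Ω (φ 0) x = 1 := by
  rw [← jacobian_id Ω x]
  congr 1
  ext y
  exact h.map_zero y

theorem IsFlowOf.jacobian_ne_zero {ξ : ∀ x : M, TangentSpace (𝓡 n) x} {φ : ℝ → M → M}
    (h : IsFlowOf ξ φ) (Ω : VolumeForm n M) (t : ℝ) (x : M) : jacobian Ω (φ t) x ≠ 0 := by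
  intro h0
  have := h.jacobian_add Ω (-t) t x
  rw [neg_add_cancel, h.jacobian_zero, h0, mul_zero] at this
  exact one_ne_zero this

theorem IsFlowOf.hasDerivAt_log_jacobian {ξ : ∀ x : M, TangentSpace (𝓡 n) x} {φ : ℝ → M → M}
    (h : IsFlowOf ξ φ) (Ω : VolumeForm n M) (t : ℝ) (x : M) :
    HasDerivAt (fun s ↦ Real.log (jacobian Ω (φ s) x)) (expansionRate Ω φ (φ t x)) t := by
  have h0 := hasDerivAt_jacobian_zero Ω h.smooth (φ t x)
  have h1 : HasDerivAt (fun s ↦ jacobian Ω (φ s) x)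
      (expansionRate Ω φ (φ t x) * jacobian Ω (φ t) x) t := by
    -- Differentiate `J_s(x) = J_{s-t}(φ_t x) * J_t(x)` at `s = t`.
    rw [← sub_self t] at h0
    have h2 := ((h0.comp_sub_const t t).mul_const (jacobian Ω (φ t) x))
    refine h2.congr_of_eventuallyEq (Filter.Eventually.of_forall fun s ↦ ?_)
    simp only [← h.jacobian_add, sub_add_cancel]
  -- `Real.log` is the logarithm of the absolute value, so nonvanishing suffices and no sign has to
  -- be determined.
  have h2 := h1.log (h.jacobian_ne_zero Ω t x)
  rwa [mul_div_cancel_right₀ _ (h.jacobian_ne_zero Ω t x)] at h2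

theorem divergence_eq_expansionRate (Ω : VolumeForm n M) {ξ : ∀ x : M, TangentSpace (𝓡 n) x}
    (h : IsFlowOf ξ (flow ξ)) : divergence Ω ξ = expansionRate Ω (flow ξ) := by
  ext x
  apply smul_form_injective Ω x
  rw [← lieDerivForm_eq_divergence_smul, lieDerivForm]
  simp_rw [pullback_eq_jacobian_smul]
  have h1 := (hasDerivAt_jacobian_zero Ω h.smooth x).smul_const
    (show Model n [⋀^Fin n]→L[ℝ] ℝ from Ω.form x)
  exact h1.deriv

theorem IsFlowOf.hasDerivAt_expansionRate {ξ : ∀ x : M, TangentSpace (𝓡 n) x}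
    (h : IsFlowOf ξ (flow ξ)) (Ω : VolumeForm n M) (x : M) (t : ℝ) :
    HasDerivAt (fun s ↦ expansionRate Ω (flow ξ) (flow ξ s x))
      (lieDerivFun ξ (divergence Ω ξ) (flow ξ t x)) t := by
  have hs (y : M) : ContDiff ℝ ∞ (fun s ↦ expansionRate Ω (flow ξ) (flow ξ s y)) :=
    ((contMDiff_expansionRate Ω h.smooth).comp
      (h.smooth.comp (contMDiff_id.prodMk contMDiff_const))).contDiff
  have h0 := ((hs (flow ξ t x)).differentiable (by simp) 0).hasDerivAt
  rw [lieDerivFun, divergence_eq_expansionRate Ω h]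
  rw [← sub_self t] at h0
  have h1 := h0.comp_sub_const t t
  rw [sub_self] at h1
  refine h1.congr_of_eventuallyEq (Filter.Eventually.of_forall fun s ↦ ?_)
  simp only [← h.map_add, sub_add_cancel]

end

end VolumeExpansion

/-! ### Change of variables in charts and the finite-volume obstruction. -/

namespace VolumeExpansion

section

open MeasureTheory Set

variable {n : ℕ} {M : Type*} [TopologicalSpace M] [ChartedSpace (Model n) M]
  [IsManifold (𝓡 n) ∞ M]

theorem hasFDerivAt_coordDeriv {g : M → M} {p q x : M}
    (hp : x ∈ (chartAt (Model n) p).source) (hq : g x ∈ (chartAt (Model n) q).source)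
    (hg : MDifferentiableAt (𝓡 n) (𝓡 n) g x) :
    HasFDerivAt (extChartAt (𝓡 n) q ∘ g ∘ (extChartAt (𝓡 n) p).symm) (coordDeriv g p q x)
      (extChartAt (𝓡 n) p x) := by
  have : IsManifold (𝓡 n) 1 M := IsManifold.of_le (n := ∞) (by simp)
  have hx : (extChartAt (𝓡 n) p).symm (extChartAt (𝓡 n) p x) = x :=
    (extChartAt (𝓡 n) p).left_inv (by simpa using hp)
  have h1 : HasMFDerivAt 𝓘(ℝ, Model n) (𝓡 n) (extChartAt (𝓡 n) p).symm (extChartAt (𝓡 n) p x)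
      ((trivializationAt (Model n) (TangentSpace (𝓡 n)) p).symmL ℝ x) := by
    have h := (mdifferentiableWithinAt_extChartAt_symm (I := 𝓡 n) (x := p)
      (z := extChartAt (𝓡 n) p x) ((extChartAt (𝓡 n) p).map_source (by simpa using hp))).hasMFDerivWithinAt
    rw [← TangentBundle.symmL_trivializationAt hp, ModelWithCorners.range_eq_univ] at h
    exact h.hasMFDerivAt Filter.univ_mem
  -- The chain rule is based at `(extChartAt (𝓡 n) p).symm (extChartAt (𝓡 n) p x)`, equal to `x`
  -- only propositionally; quantifying over `y = x` avoids transport between tangent spaces.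
  have h2 : ∀ y, y = x → HasMFDerivAt (𝓡 n) (𝓡 n) g y
      (show Model n →L[ℝ] Model n from mfderiv (𝓡 n) (𝓡 n) g x) := by
    rintro _ rfl
    exact hg.hasMFDerivAt
  have h3 : ∀ y, y = g x → HasMFDerivAt (𝓡 n) 𝓘(ℝ, Model n) (extChartAt (𝓡 n) q) y
      (show Model n →L[ℝ] Model n from
        (trivializationAt (Model n) (TangentSpace (𝓡 n)) q).continuousLinearMapAt ℝ (g x)) := by
    rintro _ rfl
    rw [TangentBundle.continuousLinearMapAt_trivializationAt hq]
    exact (mdifferentiableAt_extChartAt hq).hasMFDerivAt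
  have h4 := (h2 _ hx).comp (extChartAt (𝓡 n) p x) h1
  exact (HasMFDerivAt.comp (g := extChartAt (𝓡 n) q) (extChartAt (𝓡 n) p x)
    (h3 _ (congrArg g hx)) h4).hasFDerivAt

/-- In coordinates the determinant of `g` is the Jacobian times the ratio of densities, hence at
least `T * c / C` in absolute value on the piece of `S` sent into `K`; injectivity permits the
change of variables. -/
theorem measure_image_le_of_le_abs_jacobian (Ω : VolumeForm n M) {g : M → M} {p q : M}
    {S K : Set M} {c C T : ℝ} (hS : S ⊆ (chartAt (Model n) p).source)
    (hcS : IsCompact (S ∩ g ⁻¹' K)) (hK : K ⊆ (chartAt (Model n) q).source)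
    (hc : ∀ x ∈ S, c ≤ |Ω.density p x|) (hC0 : 0 < C) (hC : ∀ x ∈ K, |Ω.density q x| ≤ C)
    (hT0 : 0 ≤ T) (hT : ∀ x ∈ S, T ≤ |jacobian Ω g x|) (hg : MDifferentiable (𝓡 n) (𝓡 n) g)
    (hinj : Function.Injective g) :
    ENNReal.ofReal (T * c / C) * volume (extChartAt (𝓡 n) p '' (S ∩ g ⁻¹' K)) ≤
      volume (extChartAt (𝓡 n) q '' K) := by
  have hA : IsCompact (extChartAt (𝓡 n) p '' (S ∩ g ⁻¹' K)) :=
    hcS.image_of_continuousOn ((continuousOn_extChartAt p).mono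
      (by rw [extChartAt_source]; exact inter_subset_left.trans hS))
  have hleft {x : M} (hx : x ∈ S) : (extChartAt (𝓡 n) p).symm (extChartAt (𝓡 n) p x) = x :=
    (extChartAt (𝓡 n) p).left_inv (by simpa using hS hx)
  have hvol := lintegral_abs_det_fderiv_eq_addHaar_image volume hA.measurableSet
    (f := extChartAt (𝓡 n) q ∘ g ∘ (extChartAt (𝓡 n) p).symm)
    (f' := fun u ↦ coordDeriv g p q ((extChartAt (𝓡 n) p).symm u)) (by
      rintro _ ⟨x, ⟨hx, hgx⟩, rfl⟩
      rw [hleft hx]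
      exact (hasFDerivAt_coordDeriv (hS hx) (hK hgx) (hg x)).hasFDerivWithinAt) (by
      rintro _ ⟨x, ⟨hx, hgx⟩, rfl⟩ _ ⟨y, ⟨hy, hgy⟩, rfl⟩ hxy
      simp only [Function.comp_apply, hleft hx, hleft hy] at hxy
      rw [hinj ((extChartAt (𝓡 n) q).injOn (by simpa using hK hgx) (by simpa using hK hgy) hxy)])
  calc
    _ = ∫⁻ _ in extChartAt (𝓡 n) p '' (S ∩ g ⁻¹' K), ENNReal.ofReal (T * c / C) := by
      rw [setLIntegral_const]
    _ ≤ _ := by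
      refine setLIntegral_mono' hA.measurableSet ?_
      rintro _ ⟨x, ⟨hx, hgx⟩, rfl⟩
      rw [hleft hx]
      refine ENNReal.ofReal_le_ofReal ((div_le_iff₀' hC0).2 ?_)
      calc T * c ≤ |jacobian Ω g x| * |Ω.density p x| :=
            (mul_le_mul_of_nonneg_left (hc x hx) hT0).trans
              (mul_le_mul_of_nonneg_right (hT x hx) (abs_nonneg _))
        _ = |Ω.density q (g x)| * |(coordDeriv g p q x).det| := by
            rw [← abs_mul, jacobian_mul_density Ω (hK hgx), abs_mul]
        _ ≤ _ := mul_le_mul_of_nonneg_right (hC _ hgx) (abs_nonneg _)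
    _ = _ := hvol
    _ ≤ _ := by
      refine measure_mono ?_
      rintro _ ⟨_, ⟨x, ⟨hx, hgx⟩, rfl⟩, rfl⟩
      simp only [Function.comp_apply, hleft hx]
      exact mem_image_of_mem _ hgx

theorem exists_isCompact_density_bounds [LocallyCompactSpace M] (Ω : VolumeForm n M) (p : M)
    {U : Set M} (hU : U ∈ 𝓝 p) :
    ∃ K ∈ 𝓝 p, IsCompact K ∧ K ⊆ U ∧ K ⊆ (chartAt (Model n) p).source ∧
      ∃ c C : ℝ, 0 < c ∧ 0 < C ∧ ∀ x ∈ K, c ≤ |Ω.density p x| ∧ |Ω.density p x| ≤ C := by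
  have hpos : 0 < |Ω.density p p| := abs_pos.2 (density_ne_zero Ω (mem_chart_source _ _))
  have hcont : ContinuousAt (fun x ↦ |Ω.density p x|) p :=
    (Ω.contMDiffAt_density p).continuousAt.abs
  have h1 : ∀ᶠ x in 𝓝 p, |Ω.density p p| / 2 < |Ω.density p x| :=
    hcont.eventually (lt_mem_nhds (half_lt_self hpos))
  have h2 : ∀ᶠ x in 𝓝 p, |Ω.density p x| < |Ω.density p p| + 1 :=
    hcont.eventually (gt_mem_nhds (lt_add_one _))
  obtain ⟨K, hK, hKs, hKc⟩ := local_compact_nhds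
    (Filter.inter_mem (Filter.inter_mem hU (chart_source_mem_nhds (Model n) p))
      (Filter.inter_mem h1 h2))
  exact ⟨K, hK, hKc, fun x hx ↦ (hKs hx).1.1, fun x hx ↦ (hKs hx).1.2, _, _, half_pos hpos,
    by positivity, fun x hx ↦ ⟨(hKs hx).2.1.le, (hKs hx).2.2.le⟩⟩

/-- On a closed manifold, injective differentiable self-maps cannot expand the volume of a fixed
neighbourhood by arbitrarily large factors. -/
theorem exists_abs_jacobian_lt [T2Space M] [CompactSpace M] (Ω : VolumeForm n M) {x₀ : M}
    {W : Set M} (hW : W ∈ 𝓝 x₀) {g : ℕ → M → M} (hg : ∀ m, MDifferentiable (𝓡 n) (𝓡 n) (g m))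
    (hinj : ∀ m, Function.Injective (g m)) :
    ∃ m : ℕ, ∃ x ∈ W, |jacobian Ω (g m) x| < m := by
  by_contra! hlarge
  choose K hKn hKc _ hKs c C hc0 hC0 hcC using fun p ↦
    exists_isCompact_density_bounds Ω p Filter.univ_mem
  obtain ⟨S, hSn, hSc, hSW, hSs, c₀, _, hc₀, _, hcS⟩ := exists_isCompact_density_bounds Ω x₀ hW
  obtain ⟨F, hF⟩ := isCompact_univ.elim_nhds_subcover K fun x _ ↦ hKn x
  have hSpos : 0 < volume (extChartAt (𝓡 n) x₀ '' S) := by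
    refine Measure.measure_pos_of_mem_nhds volume ?_ (x := extChartAt (𝓡 n) x₀ x₀)
    exact extChartAt_image_nhds_mem_nhds_of_boundaryless hSn
  have hfin (p : M) : volume (extChartAt (𝓡 n) p '' K p) ≠ ⊤ :=
    ((hKc p).image_of_continuousOn ((continuousOn_extChartAt p).mono
      (by rw [extChartAt_source]; exact hKs p))).measure_ne_top
  -- A bound independent of `m`: if `m ≤ |J|` on `S`, the piece of `S` sent into `K p` has
  -- coordinate volume at most `C p / (m * c₀)` times that of `K p`.
  set V : ENNReal := ∑ p ∈ F, ENNReal.ofReal (C p / c₀) * volume (extChartAt (𝓡 n) p '' K p)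
  have hV : V ≠ ⊤ := by
    refine ENNReal.sum_ne_top.2 fun p _ ↦ ENNReal.mul_ne_top ENNReal.ofReal_ne_top (hfin p)
  have hbound (m : ℕ) (hm : 0 < m) : (m : ENNReal) * volume (extChartAt (𝓡 n) x₀ '' S) ≤ V := by
    have hsub : extChartAt (𝓡 n) x₀ '' S ⊆
        ⋃ p ∈ F, extChartAt (𝓡 n) x₀ '' (S ∩ g m ⁻¹' K p) := by
      rintro _ ⟨x, hx, rfl⟩
      obtain ⟨p, hp, hxp⟩ := mem_iUnion₂.1 (hF.2 (mem_univ (g m x)))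
      exact mem_iUnion₂.2 ⟨p, hp, mem_image_of_mem _ ⟨hx, hxp⟩⟩
    calc _ ≤ (m : ENNReal) * ∑ p ∈ F, volume (extChartAt (𝓡 n) x₀ '' (S ∩ g m ⁻¹' K p)) := by
          gcongr
          exact (measure_mono hsub).trans (measure_biUnion_finset_le _ _)
      _ ≤ V := by
          rw [Finset.mul_sum]
          refine Finset.sum_le_sum fun p _ ↦ ?_
          have h := measure_image_le_of_le_abs_jacobian Ω (T := m) hSs
            (hSc.inter_right ((hKc p).isClosed.preimage (hg m).continuous)) (hKs p)
            (fun x hx ↦ (hcS x hx).1) (hC0 p) (fun x hx ↦ (hcC p x hx).2) m.cast_nonneg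
            (fun x hx ↦ hlarge m x (hSW hx)) (hg m) (hinj m)
          refine le_trans (le_of_eq ?_) (mul_le_mul_right h _)
          rw [← mul_assoc, ← ENNReal.ofReal_mul (by have := hC0 p; positivity)]
          congr 1
          rw [← ENNReal.ofReal_natCast]
          congr 1
          have := (hC0 p).ne'
          field_simp
  obtain ⟨m, hm⟩ := ENNReal.exists_nat_mul_gt hSpos.ne' hV
  rcases m.eq_zero_or_pos with rfl | h0
  · simp at hm
  · exact absurd (hbound m h0) (not_le.2 hm)

end

end VolumeExpansion

/-! ### Monotone divergence must vanish. -/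

namespace VolumeExpansion

section

variable {n : ℕ} {M : Type*} [TopologicalSpace M] [ChartedSpace (Model n) M]

theorem IsFlowOf.injective {ξ : ∀ x : M, TangentSpace (𝓡 n) x} {φ : ℝ → M → M}
    (h : IsFlowOf ξ φ) (t : ℝ) : Function.Injective (φ t) := by
  intro x y hxy
  rw [← h.map_zero x, ← h.map_zero y, ← neg_add_cancel t, h.map_add, h.map_add, hxy]

/-- This covers the value given to `flow ξ` when `ξ` has no global flow, a case that does not occur
for smooth fields on closed manifolds and carries no content. -/
theorem lieDerivFun_eq_zero_of_not_exists_flow {ξ : ∀ x : M, TangentSpace (𝓡 n) x}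
    (h : ¬ ∃ φ, IsFlowOf ξ φ) (f : M → ℝ) (x : M) : lieDerivFun ξ f x = 0 := by
  simp [lieDerivFun, flow, dif_neg h]

variable [IsManifold (𝓡 n) ∞ M]

/-- If the volume grows at a rate at least `c > 0` along the orbits (followed in the direction of
the sign `σ`) of a neighbourhood, the total volume cannot be finite. -/
theorem IsFlowOf.not_uniformly_expanding [T2Space M] [CompactSpace M]
    {ξ : ∀ x : M, TangentSpace (𝓡 n) x} {φ : ℝ → M → M} (h : IsFlowOf ξ φ) (Ω : VolumeForm n M)
    {x₀ : M} {W : Set M} (hW : W ∈ 𝓝 x₀) {c : ℝ} (hc : 0 < c) (σ : ℝ) :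
    ¬ ∀ x ∈ W, ∀ t ≥ 0, c ≤ σ * expansionRate Ω φ (φ (σ * t) x) := by
  intro hexp
  have hlog (x : M) (hx : x ∈ W) (t : ℝ) (ht : 0 ≤ t) :
      c * t ≤ Real.log (jacobian Ω (φ (σ * t)) x) := by
    have hd (s : ℝ) : HasDerivAt (fun s ↦ Real.log (jacobian Ω (φ (σ * s)) x))
        (expansionRate Ω φ (φ (σ * s) x) * (σ * 1)) s :=
      HasDerivAt.comp s (h.hasDerivAt_log_jacobian Ω (σ * s) x) ((hasDerivAt_id s).const_mul σ)
    have hmvt := Convex.mul_sub_le_image_sub_of_le_deriv (convex_Ici (0 : ℝ))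
      (fun s _ ↦ (hd s).continuousAt.continuousWithinAt)
      (fun s _ ↦ (hd s).differentiableAt.differentiableWithinAt) (C := c) (fun s hs ↦ by
        rw [(hd s).deriv, mul_one, mul_comm]
        rw [interior_Ici] at hs
        exact hexp x hx s (le_of_lt hs)) 0 Set.self_mem_Ici t ht ht
    simpa [h.jacobian_zero] using hmvt
  -- At parameter `m / c` the lower bound reads `m ≤ log |J|`, while `log |J| ≤ |J| - 1`; so `|J| <
  -- m` is impossible.
  obtain ⟨m, x, hx, hlt⟩ := exists_abs_jacobian_lt Ω hW (g := fun m ↦ φ (σ * (m / c)))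
    (fun m ↦ h.mdifferentiable _) (fun m ↦ h.injective _)
  have h1 := hlog x hx (m / c) (by positivity)
  rw [mul_div_cancel₀ _ hc.ne', ← Real.log_abs] at h1
  have h2 := Real.log_le_sub_one_of_pos (abs_pos.2 (h.jacobian_ne_zero Ω (σ * (m / c)) x))
  linarith

theorem IsFlowOf.expansionRate_eq_zero [T2Space M] [CompactSpace M]
    {ξ : ∀ x : M, TangentSpace (𝓡 n) x} {φ : ℝ → M → M} (h : IsFlowOf ξ φ) (Ω : VolumeForm n M)
    (hmono : ∀ x, Monotone fun t ↦ expansionRate Ω φ (φ t x)) (x : M) :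
    expansionRate Ω φ x = 0 := by
  have hcont : Continuous (expansionRate Ω φ) := (contMDiff_expansionRate Ω h.smooth).continuous
  have hflow (y : M) : expansionRate Ω φ (φ 0 y) = expansionRate Ω φ y := by rw [h.map_zero]
  rcases lt_trichotomy (expansionRate Ω φ x) 0 with hneg | h0 | hpos
  · have hW : {y | expansionRate Ω φ y < expansionRate Ω φ x / 2} ∈ 𝓝 x :=
      (isOpen_lt hcont continuous_const).mem_nhds (by simp only [Set.mem_ofPred_eq]; linarith)
    -- Going back in time the rate can only decrease, so it stays below half its negative value at
    -- `x`; the reversed flow expands.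
    refine absurd ?_ (h.not_uniformly_expanding Ω hW (c := -(expansionRate Ω φ x / 2))
      (by linarith) (-1))
    intro y hy t ht
    have := hmono y (show -1 * t ≤ 0 by linarith)
    simp only [hflow, Set.mem_ofPred_eq] at this hy
    linarith
  · exact h0
  · have hW : {y | expansionRate Ω φ x / 2 < expansionRate Ω φ y} ∈ 𝓝 x :=
      (isOpen_lt continuous_const hcont).mem_nhds (by simp only [Set.mem_ofPred_eq]; linarith)
    refine absurd ?_ (h.not_uniformly_expanding Ω hW (half_pos hpos) 1)
    intro y hy t ht
    have := hmono y (show 0 ≤ 1 * t by linarith)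
    simp only [hflow, Set.mem_ofPred_eq] at this hy
    linarith

end

end VolumeExpansion

theorem proposition3 {n : ℕ} {M : Type*} [TopologicalSpace M] [T2Space M] [CompactSpace M]
    [ChartedSpace (EuclideanSpace ℝ (Fin n)) M] [IsManifold (𝓡 n) ∞ M]
    (Ω : VolumeExpansion.VolumeForm n M) :
    ¬ ∃ ξ : ∀ x : M, TangentSpace (𝓡 n) x,
      ContMDiff (𝓡 n) (𝓡 n).tangent ∞ (fun x ↦ (⟨x, ξ x⟩ : TangentBundle (𝓡 n) M)) ∧
      (∀ x, 0 ≤ VolumeExpansion.lieDerivFun ξ (VolumeExpansion.divergence Ω ξ) x) ∧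
      ∃ x, 0 < VolumeExpansion.lieDerivFun ξ (VolumeExpansion.divergence Ω ξ) x := by
  rintro ⟨ξ, -, hnonneg, x, hx⟩
  -- This case split takes the place of an appeal to completeness of `ξ`: without a global flow,
  -- `flow ξ` is constant in time and the strict inequality fails.
  by_cases hex : ∃ φ, VolumeExpansion.IsFlowOf ξ φ
  · have h := VolumeExpansion.isFlowOf_flow hex
    have hzero := h.expansionRate_eq_zero Ω fun y ↦
      monotone_of_hasDerivAt_nonneg (h.hasDerivAt_expansionRate Ω y) fun t ↦ hnonneg _
    have hdiv : VolumeExpansion.divergence Ω ξ = fun _ ↦ 0 := by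
      rw [VolumeExpansion.divergence_eq_expansionRate Ω h]
      exact funext hzero
    rw [hdiv] at hx
    simp [VolumeExpansion.lieDerivFun] at hx
  · rw [VolumeExpansion.lieDerivFun_eq_zero_of_not_exists_flow hex] at hx
    exact lt_irrefl 0 hx
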